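/- Let $J^\infty(\pi)$ be the infinite jet space of the trivial bundle $\pi:\mathbb R^2\times\mathbb R^m\to\mathbb R^2$, with coordinates $x$, $y$ and $u^k_I$ ($k=1,\dots,m$; $I=(a,b)$ a symmetric multiindex consisting of $a$ symbols $x$ and $b$ symbols $y$, $|I|=a+b$). Let $\mathcal F(\pi)$ be the ring of differential functions, i.e. real-valued functions on $J^\infty(\pi)$ that are smooth functions of finitely many of the coordinates; let $D_x,D_y$ be the total derivatives and $D_I=D_x^aD_y^b$. Let $F^1,\dots,F^N\in\mathcal F(\pi)$, let $\mathcal E=\{\theta\in J^\infty(\pi) : D_I(F^l)(\theta)=0 \text{ for all } l,I\}$, and let $\mathcal I(\mathcal E)\subset\mathcal F(\pi)$ be the ideal of all finite sums $\sum_{I,l}f_l^I\,D_I(F^l)$ with $f_l^I\in\mathcal F(\pi)$. Assume that $\mathcal E$ is regular: a function $f\in\mathcal F(\pi)$ vanishes on $\mathcal E$ if and only if $f\in\mathcal I(\mathcal E)$. Let $\mathfrak g\subset\mathfrak{gl}(n,\mathbb R)$ be a matrix Lie algebra. Let $\mathcal F^{\mathfrak g}(\pi)$ be the Lie algebra of $\mathfrak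 g$-valued functions on $J^\infty(\pi)$ (matrices $M$ of differential functions with $M(\theta)\in\mathfrak g$ for all $\theta$), on which derivations act entrywise; let $\mathcal I^{\mathfrak g}(\mathcal E)$ be the ideal of those $M$ with all entries in $\mathcal I(\mathcal E)$; put $\mathcal F^{\mathfrak g}(\mathcal E)=\mathcal F^{\mathfrak g}(\pi)/\mathcal I^{\mathfrak g}(\mathcal E)$ and write $M|_{\mathcal E}$ for the class of $M$; $M$ is called an extension of $M|_{\mathcal E}$ to $J^\infty(\pi)$. A $\mathfrak g$-valued zero-curvature representation (ZCR) for $\mathcal E$ is a pair $(A|_{\mathcal E},B|_{\mathcal E})\in\mathcal F^{\mathfrak g}(\mathcal E)^2$ with $(D_yA-D_xB+[A,B])|_{\mathcal E}=0$. An $N$-tuple $\chi\in\mathcal F^{\mathfrak g}(\mathcal E)^N$ is the characteristic element of this ZCR if, for some extension $(A,B)$ of it and some decomposition (a finite sum) $$D_yA-D_xB+[A,B]=\sum_{I,l}D_I(F^l)\,C_l^I\quad\text{on } J^\infty(\pi),\qquad C_l^I\in\mathcal F^{\mathfrak g}(\pi),$$ one has $\chi_l=\Big(\sum_I(-1)^{|I|}\widehat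 D_I C_l^I\Big)\Big|_{\mathcal E}$ for $l=1,\dots,N$, where $\widehat D_I=(D_x-\mathrm{ad}_A)^a(D_y-\mathrm{ad}_B)^b$ for $I=(a,b)$. Proposition. Suppose that $\mathfrak g$ is abelian, and let $\psi=(\psi_1,\dots,\psi_N)\in\mathcal F^{\mathfrak g}(\mathcal E)^N$. Then $\psi$ is the characteristic element of some $\mathfrak g$-valued ZCR for $\mathcal E$ if and only if there exist $Q_1,\dots,Q_N\in\mathcal F^{\mathfrak g}(\pi)$ with $Q_l|_{\mathcal E}=\psi_l$ for all $l$ such that, for all $k=1,\dots,m$, $$0=\sum_{l=1}^N\sum_I(-1)^{|I|}D_I\left(\frac{\partial F^l}{\partial u_I^k}\,Q_l\right)+\sum_{l=1}^N\sum_I(-1)^{|I|}D_I\left(F^l\,\frac{\partial Q_l}{\partial u_I^k}\right)$$ identically on $J^\infty(\pi)$; that is, $\mathrm E_k\big(\sum_{l}F^lQ_l\big)=0$ for all $k$, where $\mathrm E_k=\sum_I(-1)^{|I|}D_I\circ\partial/\partial u^k_I$ is the $k$-th component of the Euler operator, applied entrywise. -/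

import Mathlib

attribute [local instance] LieRing.ofAssociativeRing

namespace JetZCR

/-- Coordinates on the infinite jet space of the trivial bundle `ℝ² × ℝᵐ → ℝ²`: the independent
variables `x`, `y`, and the jet variables `u k I`, where the symmetric multiindex `I = (a, b)`
consists of `a` symbols `x` and `b` symbols `y`. -/
inductive JetCoord (m : ℕ) : Type where
  | x : JetCoord m
  | y : JetCoord m
  | u (k : Fin m) (I : ℕ × ℕ) : JetCoord m
  deriving DecidableEq

/-- The infinite jet space `J^∞(π)`: a point is the family of all its coordinates. -/
abbrev JetSpace (m : ℕ) : Type := JetCoord m → ℝ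

/-- A real function on `J^∞(π)` is a differential function if it is a smooth function of finitely
many of the coordinates. -/
def IsDifferentialFunction {m : ℕ} (f : JetSpace m → ℝ) : Prop :=
  ∃ (S : Finset (JetCoord m)) (g : (S → ℝ) → ℝ),
    ContDiff ℝ (⊤ : ℕ∞) g ∧ ∀ θ : JetSpace m, f θ = g (fun c => θ c)

theorem IsDifferentialFunction.comp₂ {m : ℕ} {f₁ f₂ : JetSpace m → ℝ}
    (h₁ : IsDifferentialFunction f₁) (h₂ : IsDifferentialFunction f₂) (φ : ℝ × ℝ → ℝ)
    (hφ : ContDiff ℝ (⊤ : ℕ∞) φ) : IsDifferentialFunction (fun θ => φ (f₁ θ, f₂ θ)) := by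
  obtain ⟨S, g, hg, hS⟩ := h₁
  obtain ⟨T, k, hk, hT⟩ := h₂
  refine ⟨S ∪ T, fun v => φ (g (fun c => v ⟨c, Finset.mem_union_left _ c.2⟩),
    k (fun c => v ⟨c, Finset.mem_union_right _ c.2⟩)), ?_, ?_⟩
  · refine hφ.comp (ContDiff.prodMk (hg.comp ?_) (hk.comp ?_))
    · exact contDiff_pi.2 fun c => contDiff_apply ℝ ℝ _
    · exact contDiff_pi.2 fun c => contDiff_apply ℝ ℝ _
  · intro θ
    simp only [hS, hT]

/-- The ring `𝓕(π)` of differential functions on `J^∞(π)`, with pointwise operations. -/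
def diffFun (m : ℕ) : Subalgebra ℝ (JetSpace m → ℝ) where
  carrier := {f | IsDifferentialFunction f}
  mul_mem' h₁ h₂ := h₁.comp₂ h₂ (fun p => p.1 * p.2) (contDiff_fst.mul contDiff_snd)
  add_mem' h₁ h₂ := h₁.comp₂ h₂ (fun p => p.1 + p.2) (contDiff_fst.add contDiff_snd)
  algebraMap_mem' r := ⟨∅, fun _ => r, contDiff_const, fun _ => rfl⟩

/-- The type of differential functions. -/
def DiffFun (m : ℕ) : Type := diffFun m

noncomputable instance (m : ℕ) : CommRing (DiffFun m) := inferInstanceAs (CommRing (diffFun m))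

noncomputable instance (m : ℕ) : Algebra ℝ (DiffFun m) := inferInstanceAs (Algebra ℝ (diffFun m))

@[ext]
theorem DiffFun.ext {m : ℕ} {f g : DiffFun m} (h : ∀ θ, f.1 θ = g.1 θ) : f = g :=
  Subtype.ext (funext h)

/-- Evaluation of differential functions at a point of `J^∞(π)`. -/
noncomputable def DiffFun.eval {m : ℕ} (θ : JetSpace m) : DiffFun m →ₐ[ℝ] ℝ :=
  (Pi.evalAlgHom ℝ (fun _ : JetSpace m => ℝ) θ).comp (diffFun m).val


/-- A coordinate, as a differential function. -/
def coord {m : ℕ} (c : JetCoord m) : DiffFun m :=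
  ⟨fun θ => θ c, {c}, fun v => v ⟨c, Finset.mem_singleton_self c⟩, contDiff_apply ℝ ℝ _,
    fun _ => rfl⟩

/-- The partial derivative with respect to the coordinate `c`, on arbitrary functions. -/
noncomputable def pderivFun {m : ℕ} (c : JetCoord m) (f : JetSpace m → ℝ) : JetSpace m → ℝ :=
  fun θ => deriv (fun t => f (Function.update θ c t)) (θ c)

theorem pderivFun_eq_zero {m : ℕ} {f : JetSpace m → ℝ} {S : Finset (JetCoord m)}
    {g : (S → ℝ) → ℝ} (hf : ∀ θ : JetSpace m, f θ = g (fun c => θ c)) {c : JetCoord m}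
    (hc : c ∉ S) : pderivFun c f = 0 := by
  funext θ
  have : (fun t => f (Function.update θ c t)) = fun _ => f θ := by
    funext t
    rw [hf, hf]
    congr 1
    funext d
    have : (d : JetCoord m) ≠ c := fun h => hc (h ▸ d.2)
    simp [Function.update_of_ne this]
  simp [pderivFun, this]

theorem hasDerivAt_jetUpdate {m : ℕ} {f : JetSpace m → ℝ} {S : Finset (JetCoord m)}
    {g : (S → ℝ) → ℝ} (hg : ContDiff ℝ (⊤ : ℕ∞) g)
    (hf : ∀ θ : JetSpace m, f θ = g (fun c => θ c)) (c : S) (θ : JetSpace m) :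
    HasDerivAt (fun t => f (Function.update θ (c : JetCoord m) t))
      (fderiv ℝ g (fun d => θ d) (Pi.single c 1)) (θ c) := by
  have h1 : HasDerivAt (fun t : ℝ => Function.update (fun d : S => θ d) c t)
      (Pi.single c (1 : ℝ)) (θ c) := hasDerivAt_update (fun d : S => θ d) c (θ c)
  have h2 : (fun t => f (Function.update θ (c : JetCoord m) t)) =
      g ∘ (fun t : ℝ => Function.update (fun d : S => θ d) c t) := by
    funext t
    simp only [hf, Function.comp]
    congr 1
    funext d
    by_cases h : d = c
    · subst h; simp
    · have h' : (d : JetCoord m) ≠ c := fun e => h (Subtype.ext e)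
      simp [Function.update_of_ne h, Function.update_of_ne h']
  rw [h2]
  have h3 : Function.update (fun d : S => θ d) c (θ c) = fun d : S => θ d :=
    Function.update_eq_self c (fun d : S => θ d)
  refine HasFDerivAt.comp_hasDerivAt (θ c) ?_ h1
  rw [h3]
  exact (hg.differentiable (by simp) _).hasFDerivAt

theorem IsDifferentialFunction.differentiableAt_update {m : ℕ} {f : JetSpace m → ℝ}
    (h : IsDifferentialFunction f) (c : JetCoord m) (θ : JetSpace m) :
    DifferentiableAt ℝ (fun t => f (Function.update θ c t)) (θ c) := by
  obtain ⟨S, g, hg, hf⟩ := h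
  by_cases hc : c ∈ S
  · exact (hasDerivAt_jetUpdate hg hf ⟨c, hc⟩ θ).differentiableAt
  · have : (fun t => f (Function.update θ c t)) = fun _ => f θ := by
      funext t
      rw [hf, hf]
      congr 1
      funext d
      have : (d : JetCoord m) ≠ c := fun h => hc (h ▸ d.2)
      simp [Function.update_of_ne this]
    rw [this]
    exact differentiableAt_const _

theorem IsDifferentialFunction.pderivFun {m : ℕ} {f : JetSpace m → ℝ}
    (h : IsDifferentialFunction f) (c : JetCoord m) :
    IsDifferentialFunction (pderivFun c f) := by
  obtain ⟨S, g, hg, hf⟩ := h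
  by_cases hc : c ∈ S
  · refine ⟨S, fun v => fderiv ℝ g v (Pi.single ⟨c, hc⟩ 1), ?_, fun θ => ?_⟩
    · exact (hg.fderiv_right (by simp)).clm_apply contDiff_const
    · exact (hasDerivAt_jetUpdate hg hf ⟨c, hc⟩ θ).deriv
  · rw [pderivFun_eq_zero hf hc]
    exact (diffFun m).zero_mem

/-- The partial derivative `∂/∂c : 𝓕(π) → 𝓕(π)`. -/
noncomputable def pderiv {m : ℕ} (c : JetCoord m) : Derivation ℝ (DiffFun m) (DiffFun m) :=
  Derivation.mk'
    { toFun := fun f => ⟨pderivFun c f.1, f.2.pderivFun c⟩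
      map_add' := fun f g => by
        ext θ
        exact deriv_add (f.2.differentiableAt_update c θ) (g.2.differentiableAt_update c θ)
      map_smul' := fun r f => by
        ext θ
        exact deriv_const_smul r (f.2.differentiableAt_update c θ) }
    (fun f g => by
      ext θ
      have := deriv_mul (f.2.differentiableAt_update c θ) (g.2.differentiableAt_update c θ)
      simp only [Function.update_eq_self] at this
      change deriv ((fun t => f.1 (Function.update θ c t)) *
        fun t => g.1 (Function.update θ c t)) (θ c) =
        f.1 θ * deriv (fun t => g.1 (Function.update θ c t)) (θ c)
        + g.1 θ *
          deriv (fun t => f.1 (Function.update θ c t)) (θ c)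
      rw [this]
      ring)

theorem finite_pderiv_ne_zero {m : ℕ} (f : DiffFun m) : {c | pderiv c f ≠ 0}.Finite := by
  obtain ⟨S, g, hg, hf⟩ := f.2
  refine S.finite_toSet.subset fun c hc => ?_
  by_contra h
  exact hc (DiffFun.ext fun θ => congrFun (pderivFun_eq_zero hf h) θ)

theorem finite_support_mul_pderiv {m : ℕ} (X : JetCoord m → DiffFun m) (f : DiffFun m) :
    (Function.support fun c => X c * pderiv c f).Finite :=
  (finite_pderiv_ne_zero f).subset fun c hc h => hc (by simp [h])

/-- The vector field `∑_c X^c ∂/∂c` on `J^∞(π)`, acting on differential functions. The sum has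
only finitely many nonzero terms on each differential function. -/
noncomputable def vectorField {m : ℕ} (X : JetCoord m → DiffFun m) :
    Derivation ℝ (DiffFun m) (DiffFun m) :=
  Derivation.mk'
    { toFun := fun f => ∑ᶠ c, X c * pderiv c f
      map_add' := fun f g => by
        simp only [map_add, mul_add]
        exact finsum_add_distrib (finite_support_mul_pderiv X f) (finite_support_mul_pderiv X g)
      map_smul' := fun r f => by
        simp only [Derivation.map_smul, mul_smul_comm, RingHom.id_apply]
        exact (smul_finsum' r (finite_support_mul_pderiv X f)).symm }
    (fun f g => by
      have h1 := smul_finsum' f (finite_support_mul_pderiv X g)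
      have h2 := smul_finsum' g (finite_support_mul_pderiv X f)
      have h3 : (Function.support fun c => f • (X c * pderiv c g)).Finite :=
        (finite_support_mul_pderiv X g).subset fun c hc h => hc (by simp [h])
      have h4 : (Function.support fun c => g • (X c * pderiv c f)).Finite :=
        (finite_support_mul_pderiv X f).subset fun c hc h => hc (by simp [h])
      change ∑ᶠ c, X c * pderiv c (f * g) =
        f • (∑ᶠ c, X c * pderiv c g) + g • ∑ᶠ c, X c * pderiv c f
      rw [h1, h2, ← finsum_add_distrib h3 h4]
      refine finsum_congr fun c => ?_
      simp only [Derivation.leibniz, smul_eq_mul]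
      ring)

/-- The total derivative `D_x = ∂/∂x + ∑_{k,I} u^k_{I,x} ∂/∂u^k_I`. -/
noncomputable def Dx (m : ℕ) : Derivation ℝ (DiffFun m) (DiffFun m) :=
  vectorField fun
    | .x => 1
    | .y => 0
    | .u k (a, b) => coord (.u k (a + 1, b))

/-- The total derivative `D_y = ∂/∂y + ∑_{k,I} u^k_{I,y} ∂/∂u^k_I`. -/
noncomputable def Dy (m : ℕ) : Derivation ℝ (DiffFun m) (DiffFun m) :=
  vectorField fun
    | .x => 0
    | .y => 1
    | .u k (a, b) => coord (.u k (a, b + 1))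

/-- The iterated total derivative `D_I = D_x^a D_y^b` for `I = (a, b)`. -/
noncomputable def DI {m : ℕ} (I : ℕ × ℕ) (f : DiffFun m) : DiffFun m :=
  (Dx m)^[I.1] ((Dy m)^[I.2] f)

/-- The sign `(-1)^|I|`, where `|I| = a + b` for `I = (a, b)`. -/
def sgn (I : ℕ × ℕ) : ℝ := (-1) ^ (I.1 + I.2)

/-! ### The equation manifold -/

/-- The set `𝓔 ⊆ J^∞(π)` cut out by the system `F^l = 0` and all its differential consequences. -/
def equationManifold {m N : ℕ} (F : Fin N → DiffFun m) : Set (JetSpace m) :=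
  {θ | ∀ l I, (DI I (F l)).1 θ = 0}

/-- The ideal `𝓘(𝓔)` of all finite sums `∑_{I,l} f_l^I D_I(F^l)`. -/
noncomputable def equationIdeal {m N : ℕ} (F : Fin N → DiffFun m) : Ideal (DiffFun m) :=
  Ideal.span (Set.range fun p : Fin N × (ℕ × ℕ) => DI p.2 (F p.1))

/-- The regularity condition: a differential function vanishes on `𝓔` if and only if it is
`Δ(F^1, …, F^N)` for some `𝓒`-differential operator `Δ`, that is, a finite sum
`∑_{I,l} a_{I,l} D_I(F^l)`. -/
def IsRegularSystem {m N : ℕ} (F : Fin N → DiffFun m) : Prop :=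
  ∀ f : DiffFun m, (∀ θ ∈ equationManifold F, f.1 θ = 0) ↔
    ∃ a : Fin N × (ℕ × ℕ) →₀ DiffFun m, f = a.sum fun p a_p => a_p * DI p.2 (F p.1)

/-! ### `𝔤`-valued functions -/

/-- The value at a point of a matrix of differential functions. -/
def evalAt {m n : ℕ} (θ : JetSpace m) (M : Matrix (Fin n) (Fin n) (DiffFun m)) :
    Matrix (Fin n) (Fin n) ℝ :=
  M.map fun f => f.1 θ

theorem evalAt_mul {m n : ℕ} (θ : JetSpace m) (M L : Matrix (Fin n) (Fin n) (DiffFun m)) :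
    evalAt θ (M * L) = evalAt θ M * evalAt θ L := by
  exact Matrix.map_mul (f := (DiffFun.eval θ).toRingHom)

theorem evalAt_sub {m n : ℕ} (θ : JetSpace m) (M L : Matrix (Fin n) (Fin n) (DiffFun m)) :
    evalAt θ (M - L) = evalAt θ M - evalAt θ L := rfl

variable {n : ℕ}

/-- The Lie algebra `𝓕^𝔤(π)` of `𝔤`-valued functions on `J^∞(π)`: matrices `M` of differential
functions with `M(θ) ∈ 𝔤` for all `θ ∈ J^∞(π)`, with the pointwise bracket and with
multiplication by differential functions. -/
noncomputable def gFun (𝔤 : LieSubalgebra ℝ (Matrix (Fin n) (Fin n) ℝ)) (m : ℕ) :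
    LieSubalgebra (DiffFun m) (Matrix (Fin n) (Fin n) (DiffFun m)) where
  carrier := {M | ∀ θ, evalAt θ M ∈ 𝔤}
  add_mem' h₁ h₂ θ := 𝔤.add_mem (h₁ θ) (h₂ θ)
  zero_mem' _ := 𝔤.zero_mem
  smul_mem' f _ h θ := 𝔤.smul_mem (f.1 θ) (h θ)
  lie_mem' {M L} h₁ h₂ θ := by
    have := 𝔤.lie_mem (h₁ θ) (h₂ θ)
    rw [Ring.lie_def] at this ⊢
    rwa [evalAt_sub, evalAt_mul, evalAt_mul]

abbrev GFun (𝔤 : LieSubalgebra ℝ (Matrix (Fin n) (Fin n) ℝ)) (m : ℕ) : Type := gFun 𝔤 m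

theorem map_mem_gFun {m : ℕ} {𝔤 : LieSubalgebra ℝ (Matrix (Fin n) (Fin n) ℝ)}
    (D : DiffFun m →ₗ[ℝ] DiffFun m) {M : Matrix (Fin n) (Fin n) (DiffFun m)}
    (hM : M ∈ gFun 𝔤 m) : M.map D ∈ gFun 𝔤 m := by
  intro θ
  by_contra hθ
  obtain ⟨φ, hφ, hle⟩ := Submodule.exists_le_ker_of_notMem (p := 𝔤.toSubmodule) hθ
  have key : ∀ A : Matrix (Fin n) (Fin n) ℝ,
      φ A = ∑ i, ∑ j, φ (Matrix.single i j 1) * A i j := by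
    intro A
    conv_lhs => rw [Matrix.matrix_eq_sum_single A]
    simp only [map_sum]
    refine Finset.sum_congr rfl fun i _ => Finset.sum_congr rfl fun j _ => ?_
    rw [mul_comm, ← smul_eq_mul, ← map_smul, Matrix.smul_single, smul_eq_mul, mul_one]
  have h0 : ∑ i, ∑ j, φ (Matrix.single i j 1) • M i j = 0 := by
    refine DiffFun.ext fun η => ?_
    have h := hle (hM η)
    rw [LinearMap.mem_ker, key] at h
    change DiffFun.eval η _ = DiffFun.eval η 0
    simp only [map_sum, map_smul, map_zero, smul_eq_mul]
    exact h
  have h1 := congrArg (DiffFun.eval θ) (congrArg D h0)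
  simp only [map_sum, map_smul, map_zero, smul_eq_mul] at h1
  exact hφ ((key _).trans h1)

/-- A derivation of the ring of differential functions, applied to a `𝔤`-valued function entrywise. -/
noncomputable def entrywise {m : ℕ} {𝔤 : LieSubalgebra ℝ (Matrix (Fin n) (Fin n) ℝ)}
    (D : Derivation ℝ (DiffFun m) (DiffFun m)) (M : GFun 𝔤 m) : GFun 𝔤 m :=
  ⟨M.1.map D, map_mem_gFun (D : DiffFun m →ₗ[ℝ] DiffFun m) M.2⟩

/-- The operator `D_I = D_x^a D_y^b`, `I = (a, b)`, on `𝔤`-valued functions. -/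
noncomputable def gDI {m : ℕ} {𝔤 : LieSubalgebra ℝ (Matrix (Fin n) (Fin n) ℝ)} (I : ℕ × ℕ)
    (M : GFun 𝔤 m) : GFun 𝔤 m :=
  (entrywise (Dx m))^[I.1] ((entrywise (Dy m))^[I.2] M)

/-- The operator `D̂_I = (D_x - ad_A)^a (D_y - ad_B)^b`, `I = (a, b)`, on `𝔤`-valued functions. -/
noncomputable def hatDI {m : ℕ} {𝔤 : LieSubalgebra ℝ (Matrix (Fin n) (Fin n) ℝ)}
    (A B : GFun 𝔤 m) (I : ℕ × ℕ) (M : GFun 𝔤 m) : GFun 𝔤 m :=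
  (fun L => entrywise (Dx m) L - ⁅A, L⁆)^[I.1] ((fun L => entrywise (Dy m) L - ⁅B, L⁆)^[I.2] M)

/-- The ideal `𝓘^𝔤(𝓔)` of all `𝔤`-valued functions with all entries in `𝓘(𝓔)`. -/
noncomputable def gIdeal (𝔤 : LieSubalgebra ℝ (Matrix (Fin n) (Fin n) ℝ)) {m N : ℕ}
    (F : Fin N → DiffFun m) :
    LieIdeal (DiffFun m) (GFun 𝔤 m) where
  carrier := {M | ∀ i j, M.1 i j ∈ equationIdeal F}
  add_mem' h₁ h₂ i j := (equationIdeal F).add_mem (h₁ i j) (h₂ i j)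
  zero_mem' _ _ := (equationIdeal F).zero_mem
  smul_mem' f _ h i j := (equationIdeal F).mul_mem_left f (h i j)
  lie_mem {L M} h i j := by
    change (L.1 * M.1 - M.1 * L.1) i j ∈ _
    rw [Matrix.sub_apply, Matrix.mul_apply, Matrix.mul_apply]
    exact (equationIdeal F).sub_mem
      ((equationIdeal F).sum_mem fun k _ => (equationIdeal F).mul_mem_left _ (h k j))
      ((equationIdeal F).sum_mem fun k _ => (equationIdeal F).mul_mem_right _ (h i k))

/-- The Lie algebra `𝓕^𝔤(𝓔) = 𝓕^𝔤(π) / 𝓘^𝔤(𝓔)` of `𝔤`-valued functions on `𝓔`. -/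
abbrev GFunOn (𝔤 : LieSubalgebra ℝ (Matrix (Fin n) (Fin n) ℝ)) {m N : ℕ}
    (F : Fin N → DiffFun m) : Type :=
  GFun 𝔤 m ⧸ gIdeal 𝔤 F

/-- The restriction `M ↦ M|_𝓔`; `M` is then an extension of `M|_𝓔` to `J^∞(π)`. -/
noncomputable def restrict {𝔤 : LieSubalgebra ℝ (Matrix (Fin n) (Fin n) ℝ)} {m N : ℕ}
    (F : Fin N → DiffFun m) (M : GFun 𝔤 m) : GFunOn 𝔤 F :=
  LieSubmodule.Quotient.mk M

/-! ### Zero-curvature representations -/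

/-- The left-hand side `D_y A - D_x B + [A, B]` of the Maurer-Cartan condition. -/
noncomputable def curvature {𝔤 : LieSubalgebra ℝ (Matrix (Fin n) (Fin n) ℝ)} {m : ℕ}
    (A B : GFun 𝔤 m) : GFun 𝔤 m :=
  entrywise (Dy m) A - entrywise (Dx m) B + ⁅A, B⁆

/-- A `𝔤`-valued zero-curvature representation for `𝓔`: a pair of `𝔤`-valued functions on `𝓔`
with representatives that satisfy the Maurer-Cartan condition on `𝓔`. (If one pair of
representatives satisfies it, all do.) -/
structure ZeroCurvRep (𝔤 : LieSubalgebra ℝ (Matrix (Fin n) (Fin n) ℝ)) {m N : ℕ}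
    (F : Fin N → DiffFun m) where
  α : GFunOn 𝔤 F
  β : GFunOn 𝔤 F
  maurerCartan : ∃ A B : GFun 𝔤 m, restrict F A = α ∧ restrict F B = β ∧
    restrict F (curvature A B) = 0

/-- `χ` is the characteristic element of the ZCR `(α, β)`: for some extension `(A, B)` of `(α, β)`
and some decomposition `D_y A - D_x B + [A, B] = ∑_{I,l} D_I(F^l) C_l^I` on `J^∞(π)` with
`𝔤`-valued functions `C_l^I`, one has `χ_l = ∑_I (-1)^|I| D̂_I C_l^I` on `𝓔`. -/
def IsCharacteristicElement {𝔤 : LieSubalgebra ℝ (Matrix (Fin n) (Fin n) ℝ)} {m N : ℕ}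
    {F : Fin N → DiffFun m} (Z : ZeroCurvRep 𝔤 F) (χ : Fin N → GFunOn 𝔤 F) : Prop :=
  ∃ (A B : GFun 𝔤 m) (C : Fin N → (ℕ × ℕ →₀ GFun 𝔤 m)),
    restrict F A = Z.α ∧ restrict F B = Z.β ∧
    curvature A B = ∑ l, (C l).sum (fun I c => DI I (F l) • c) ∧
    ∀ l, χ l = restrict F (∑ I ∈ (C l).support, sgn I • hatDI A B I (C l I))

end JetZCR

open JetZCR

/-!
The proof rests on the description of total divergences by the Euler operator: a differential
function is of the form `D_y a - D_x b` if and only if all `E_k` annihilate it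
(`euler_eq_zero_of_mem_range_divergence`, `mem_range_divergence_of_euler_eq_zero`). Since `𝔤` is
abelian, all brackets of `𝔤`-valued functions vanish, so the curvature of `(A, B)` is the total
divergence `D_y A - D_x B` and the operators `D̂_I` are the `D_I`.

Given a characteristic element, put `Q_l = ∑_I (-1)^|I| D_I C_l^I`. Integration by parts
(`mul_linDI_sub_mem`) shows that `∑ F^l Q_l` equals `∑ D_I(F^l) C_l^I = D_y A - D_x B` up to total
divergences, so the Euler operator annihilates it. Conversely, if the Euler operator annihilates
`∑ F^l Q_l`, every matrix entry of this function is a total divergence. The potentials can be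
chosen `ℝ`-linearly in the entry, and an `ℝ`-linear operator applied entrywise preserves
`𝔤`-valued functions; this gives `𝔤`-valued `A`, `B` with `D_y A - D_x B = ∑ F^l Q_l`
(`exists_potentials`), and the right-hand side is a decomposition with characteristic element `Q`.

The substantial part is that the kernel of the Euler operator consists of divergences. It is
proved by the homotopy along `t ↦ (x, y, t u)`. As `∂/∂u^k_I` is taken before the pullback, the
homotopy formula involves no division by `t`, and its averages `∫₀¹ f(x, y, t u) dt` (`average`)
are again differential functions that commute with `D_x` and `D_y`. What remains is a function of
`x` and `y` alone, which is integrated in `y` by the same averages with another choice of weights.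
-/

namespace JetZCR

open MeasureTheory intervalIntegral

variable {m n : ℕ}

/-! ### Smooth dependence of integrals on parameters -/

theorem hasFDerivAt_integral_of_contDiff {H E : Type} [NormedAddCommGroup H] [NormedSpace ℝ H]
    [ProperSpace H] [NormedAddCommGroup E] [NormedSpace ℝ E]
    {h : H × ℝ → E} (hh : ContDiff ℝ 1 h) (v : H) :
    HasFDerivAt (fun w => ∫ t in (0 : ℝ)..1, h (w, t))
      (∫ t in (0 : ℝ)..1, (fderiv ℝ h (v, t)).comp (ContinuousLinearMap.inl ℝ H ℝ)) v := by
  have hd : Continuous fun q : H × ℝ => (fderiv ℝ h q).comp (ContinuousLinearMap.inl ℝ H ℝ) :=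
    (hh.continuous_fderiv (by simp)).clm_comp continuous_const
  obtain ⟨M, hM⟩ := ((isCompact_closedBall v 1).prod (isCompact_Icc (a := (0 : ℝ)) (b := 1))
    ).exists_bound_of_continuousOn hd.continuousOn
  have hc : ∀ w, Continuous fun t => h (w, t) := fun w =>
    hh.continuous.comp (continuous_const.prodMk continuous_id)
  have hdc : Continuous fun t => (fderiv ℝ h (v, t)).comp (ContinuousLinearMap.inl ℝ H ℝ) :=
    hd.comp (continuous_const.prodMk continuous_id)
  refine hasFDerivAt_integral_of_dominated_of_fderiv_le (bound := fun _ => M)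
    (F' := fun w t => (fderiv ℝ h (w, t)).comp (ContinuousLinearMap.inl ℝ H ℝ))
    (Metric.ball_mem_nhds v one_pos)
    (Filter.Eventually.of_forall fun w => (hc w).aestronglyMeasurable)
    ((hc v).intervalIntegrable _ _) hdc.aestronglyMeasurable ?_ (by simp) ?_
  · refine Filter.Eventually.of_forall fun t ht w hw =>
      hM (w, t) ⟨Metric.ball_subset_closedBall hw, ?_⟩
    rw [Set.uIoc_of_le zero_le_one] at ht
    exact ⟨ht.1.le, ht.2⟩
  · refine Filter.Eventually.of_forall fun t _ w _ => ?_
    exact ((hh.differentiable (by simp) (w, t)).hasFDerivAt).comp w (hasFDerivAt_prodMk_left w t)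

/-- The derivative of a parametric integral is again a parametric integral, with values in the
space of linear maps; hence the induction on the order of smoothness generalizes the target space.
-/
theorem contDiff_integral {H E : Type} [NormedAddCommGroup H] [NormedSpace ℝ H]
    [ProperSpace H] [NormedAddCommGroup E] [NormedSpace ℝ E]
    {h : H × ℝ → E} (hh : ContDiff ℝ (⊤ : ℕ∞) h) :
    ContDiff ℝ (⊤ : ℕ∞) (fun w => ∫ t in (0 : ℝ)..1, h (w, t)) := by
  refine contDiff_infty.2 fun r => ?_
  induction r generalizing E with
  | zero =>
    refine contDiff_zero.2 ?_
    exact continuous_parametric_intervalIntegral_of_continuous' (f := fun w t => h (w, t))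
      hh.continuous 0 1
  | succ r ih =>
    have h1 := hasFDerivAt_integral_of_contDiff (hh.of_le (by exact_mod_cast le_top))
    have h2 : ContDiff ℝ ((r : WithTop ℕ∞) + 1) fun w => ∫ t in (0 : ℝ)..1, h (w, t) := by
      refine contDiff_succ_iff_fderiv.2 ⟨fun v => (h1 v).differentiableAt, fun h => ?_, ?_⟩
      · exact absurd h (by exact_mod_cast WithTop.coe_ne_top)
      rw [funext fun v => (h1 v).fderiv]
      exact ih (h := fun q => (fderiv ℝ h q).comp (ContinuousLinearMap.inl ℝ H ℝ))
        ((hh.fderiv_right (by simp)).clm_comp contDiff_const)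
    exact_mod_cast h2


/-! ### The chain rule for differential functions -/

/-- `J^∞(π)` carries no smooth structure here; a map into it counts as smooth when all its
coordinates are. -/
theorem DiffFun.contDiff_comp {H : Type*} [NormedAddCommGroup H] [NormedSpace ℝ H]
    (f : DiffFun m) {Φ : H → JetSpace m} (hΦ : ∀ c, ContDiff ℝ (⊤ : ℕ∞) fun v => Φ v c) :
    ContDiff ℝ (⊤ : ℕ∞) fun v => f.1 (Φ v) := by
  obtain ⟨S, g, hg, hf⟩ := f.2
  simp only [hf]
  exact hg.comp (contDiff_pi.2 fun c => hΦ c)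

/-- The chain rule along a curve in `J^∞(π)` all of whose coordinates are differentiable. -/
theorem DiffFun.hasDerivAt_comp (f : DiffFun m) {γ : ℝ → JetSpace m} {γ' : JetCoord m → ℝ} {t : ℝ}
    (hγ : ∀ c, HasDerivAt (fun s => γ s c) (γ' c) t) :
    HasDerivAt (fun s => f.1 (γ s)) (∑ᶠ c, γ' c * (pderiv c f).1 (γ t)) t := by
  obtain ⟨S, g, hg, hf⟩ := f.2
  have h1 : ∑ᶠ c, γ' c * (pderiv c f).1 (γ t) =
      fderiv ℝ g (fun c : S => γ t c) fun c => γ' c := by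
    have h2 : (fun c : S => γ' c) = ∑ c : S, γ' c • (Pi.single c 1 : S → ℝ) := by
      funext d
      simp [Finset.sum_apply, Pi.single_apply]
    rw [h2, map_sum, finsum_eq_sum_of_support_subset (s := S), ← Finset.sum_coe_sort S]
    · refine Finset.sum_congr rfl fun c _ => ?_
      rw [map_smul, smul_eq_mul]
      congr 1
      exact (hasDerivAt_jetUpdate hg hf c (γ t)).deriv
    · intro c hc
      by_contra h
      refine hc ?_
      have : (pderiv c f).1 (γ t) = 0 := congrFun (pderivFun_eq_zero hf h) (γ t)
      simp [this]
  rw [h1]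
  simp only [hf]
  refine HasFDerivAt.comp_hasDerivAt t (hg.differentiable (by simp) _).hasFDerivAt ?_
  exact hasDerivAt_pi.2 fun c => hγ c

/-- If one of the coordinates does not occur in `f`, both sides vanish; otherwise this is the
symmetry of the second derivative of a smooth function of the finitely many coordinates on which
`f` depends. -/
theorem pderiv_comm (c d : JetCoord m) (f : DiffFun m) :
    pderiv c (pderiv d f) = pderiv d (pderiv c f) := by
  obtain ⟨S, g, hg, hf⟩ := f.2
  have hz : ∀ c d : JetCoord m, c ∉ S → pderiv c (pderiv d f) = pderiv d (pderiv c f) := by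
    intro c d hc
    have h0 : pderiv c f = 0 := DiffFun.ext fun θ => congrFun (pderivFun_eq_zero hf hc) θ
    rw [h0, map_zero]
    by_cases hd : d ∈ S
    · exact DiffFun.ext fun θ => congrFun (pderivFun_eq_zero (f := (pderiv d f).1)
        (g := fun v => fderiv ℝ g v (Pi.single ⟨d, hd⟩ 1))
        (fun θ => (hasDerivAt_jetUpdate hg hf ⟨d, hd⟩ θ).deriv) hc) θ
    · have h0 : pderiv d f = 0 := DiffFun.ext fun θ => congrFun (pderivFun_eq_zero hf hd) θ
      rw [h0, map_zero]
  by_cases hc : c ∈ S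
  · by_cases hd : d ∈ S
    · have key : ∀ (c d : S) (θ : JetSpace m), (pderiv c.1 (pderiv d.1 f)).1 θ =
          fderiv ℝ (fderiv ℝ g) (fun e => θ e) (Pi.single c 1) (Pi.single d 1) := by
        intro c d θ
        have h1 : ContDiff ℝ (⊤ : ℕ∞) (fderiv ℝ g) := hg.fderiv_right (by simp)
        refine ((hasDerivAt_jetUpdate (f := (pderiv d.1 f).1)
          (g := fun v => fderiv ℝ g v (Pi.single d 1))
          (h1.clm_apply contDiff_const)
          (fun θ => (hasDerivAt_jetUpdate hg hf d θ).deriv) c θ).deriv).trans ?_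
        have h2 := ((h1.differentiable (by simp) (fun e => θ e)).hasFDerivAt).clm_apply
          (hasFDerivAt_const (Pi.single d (1 : ℝ)) (fun e : S => θ e))
        rw [h2.fderiv]
        simp
      refine DiffFun.ext fun θ => ?_
      rw [key ⟨c, hc⟩ ⟨d, hd⟩ θ, key ⟨d, hd⟩ ⟨c, hc⟩ θ]
      have h1 : ContDiff ℝ (⊤ : ℕ∞) (fderiv ℝ g) := hg.fderiv_right (by simp)
      exact second_derivative_symmetric
        (fun v => (hg.differentiable (by simp) v).hasFDerivAt)
        (h1.differentiable (by simp) _).hasFDerivAt _ _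
    · exact (hz d c hd).symm
  · exact hz c d hc

theorem pderiv_coord (c d : JetCoord m) :
    pderiv c (coord d) = if c = d then (1 : DiffFun m) else 0 := by
  refine DiffFun.ext fun θ => ?_
  change deriv (fun t => Function.update θ c t d) (θ c) = _
  split_ifs with h
  · subst h
    simp only [Function.update_self, deriv_id'']
    rfl
  · simp only [Function.update_of_ne (Ne.symm h), deriv_const]
    rfl

/-! ### Weighted dilations -/

/-- The dilation with weights `w`, multiplying each coordinate `c` by `t ^ w c`. Coordinates of
weight zero are fixed for every `t`, including `t = 0`, as `0 ^ 0 = 1`. -/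
def dilate (w : JetCoord m → ℕ) (t : ℝ) (θ : JetSpace m) : JetSpace m := fun c => t ^ w c * θ c

@[simp]
theorem dilate_one (w : JetCoord m → ℕ) (θ : JetSpace m) : dilate w 1 θ = θ := by
  funext c
  simp [dilate]

theorem DiffFun.contDiff_dilate (f : DiffFun m) (w : JetCoord m → ℕ) (θ : JetSpace m) :
    ContDiff ℝ (⊤ : ℕ∞) fun t => f.1 (dilate w t θ) :=
  f.contDiff_comp fun c => (contDiff_id.pow (w c)).mul contDiff_const

theorem DiffFun.hasDerivAt_dilate_update (f : DiffFun m) (w : JetCoord m → ℕ) (t : ℝ)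
    (c : JetCoord m) (θ : JetSpace m) (s : ℝ) :
    HasDerivAt (fun s => f.1 (dilate w t (Function.update θ c s)))
      (t ^ w c * (pderiv c f).1 (dilate w t (Function.update θ c s))) s := by
  have h := f.hasDerivAt_comp (γ := fun s => dilate w t (Function.update θ c s))
    (γ' := fun d => if d = c then t ^ w c else 0) (t := s) (fun d => ?_)
  · rw [finsum_eq_single _ c (fun d hd => by simp [hd])] at h
    simpa using h
  · unfold dilate
    split_ifs with h
    · subst h
      simpa using (hasDerivAt_id s).const_mul (t ^ w d)
    · simpa [Function.update_of_ne h] using hasDerivAt_const s _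

/-- The pullback of a differential function along a weighted dilation. -/
noncomputable def dilation (w : JetCoord m → ℕ) (t : ℝ) (f : DiffFun m) : DiffFun m :=
  ⟨fun θ => f.1 (dilate w t θ), by
    obtain ⟨S, g, hg, hf⟩ := f.2
    refine ⟨S, fun v => g fun c => t ^ w c * v c, ?_, fun θ => hf _⟩
    exact hg.comp (contDiff_pi.2 fun c => contDiff_const.mul (contDiff_apply ℝ ℝ c))⟩

theorem pderiv_dilation (w : JetCoord m → ℕ) (t : ℝ) (f : DiffFun m) (c : JetCoord m) :
    pderiv c (dilation w t f) = t ^ w c • dilation w t (pderiv c f) := by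
  refine DiffFun.ext fun θ => ?_
  have := (f.hasDerivAt_dilate_update w t c θ (θ c)).deriv
  rw [Function.update_eq_self] at this
  exact this

/-- The weighted average `f ↦ ∫₀¹ t ^ p f(dilate w t θ) dt` along the dilations with weights `w`. -/
noncomputable def average (w : JetCoord m → ℕ) (p : ℕ) : DiffFun m →ₗ[ℝ] DiffFun m where
  toFun f := ⟨fun θ => ∫ t in (0 : ℝ)..1, t ^ p * f.1 (dilate w t θ), by
    obtain ⟨S, g, hg, hf⟩ := f.2
    refine ⟨S, fun v => ∫ t in (0 : ℝ)..1, t ^ p * g fun c => t ^ w c * v c, ?_, fun θ => ?_⟩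
    · refine contDiff_integral (h := fun q : (S → ℝ) × ℝ => q.2 ^ p * g fun c => q.2 ^ w c * q.1 c)
        ((contDiff_snd.pow p).mul (hg.comp (contDiff_pi.2 fun c =>
          (contDiff_snd.pow (w c)).mul ?_)))
      exact (contDiff_apply ℝ ℝ c).comp contDiff_fst
    · simp only [hf]
      rfl⟩
  map_add' f g := by
    refine DiffFun.ext fun θ => ?_
    have h : ∀ f : DiffFun m, IntervalIntegrable (fun t => t ^ p * f.1 (dilate w t θ)) volume 0 1 :=
      fun f => ((continuous_id.pow p).mul (f.contDiff_dilate w θ).continuous).intervalIntegrable _ _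
    refine Eq.trans ?_ (integral_add (h f) (h g))
    exact integral_congr fun t _ => mul_add _ _ _
  map_smul' r f := by
    refine DiffFun.ext fun θ => ?_
    refine Eq.trans ?_ (integral_const_mul r _)
    exact integral_congr fun t _ => mul_left_comm _ _ _

theorem pderiv_average (w : JetCoord m → ℕ) (p : ℕ) (f : DiffFun m) (c : JetCoord m) :
    pderiv c (average w p f) = average w (p + w c) (pderiv c f) := by
  refine DiffFun.ext fun θ => ?_
  have hs : ContDiff ℝ (⊤ : ℕ∞) fun q : ℝ × ℝ =>
      q.2 ^ p * f.1 (dilate w q.2 (Function.update θ c q.1)) := by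
    refine (contDiff_snd.pow p).mul (f.contDiff_comp fun d => (contDiff_snd.pow (w d)).mul ?_)
    by_cases h : d = c
    · subst h
      simpa using contDiff_fst
    · simpa [Function.update_of_ne h] using contDiff_const
  have hd := (hasFDerivAt_integral_of_contDiff (hs.of_le (by exact_mod_cast le_top))
    (θ c)).hasDerivAt
  refine hd.deriv.trans ?_
  have hc : Continuous fun t : ℝ => (fderiv ℝ (fun q : ℝ × ℝ =>
      q.2 ^ p * f.1 (dilate w q.2 (Function.update θ c q.1))) (θ c, t)).comp
        (ContinuousLinearMap.inl ℝ ℝ ℝ) :=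
    ((hs.continuous_fderiv (by simp)).comp
      (continuous_const.prodMk continuous_id)).clm_comp continuous_const
  refine (ContinuousLinearMap.intervalIntegral_apply (hc.intervalIntegrable _ _) _).trans ?_
  refine integral_congr fun t _ => ?_
  have h1 : HasDerivAt (fun s => t ^ p * f.1 (dilate w t (Function.update θ c s))) _ (θ c) :=
    (f.hasDerivAt_dilate_update w t c θ (θ c)).const_mul (t ^ p)
  have h2 := HasFDerivAt.comp (f := fun s : ℝ => (s, t)) (θ c)
    (hs.differentiable (by simp) (θ c, t)).hasFDerivAt
    (hasFDerivAt_prodMk_left (θ c) t)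
  have h3 := h2.hasDerivAt.unique h1
  rw [Function.update_eq_self] at h3
  refine h3.trans ?_
  rw [pow_add, mul_assoc]

theorem average_coord_mul (w : JetCoord m → ℕ) (p : ℕ) (f : DiffFun m) (c : JetCoord m) :
    average w p (coord c * f) = coord c * average w (p + w c) f := by
  refine DiffFun.ext fun θ => ?_
  refine Eq.trans ?_ (integral_const_mul (θ c) _)
  refine integral_congr fun t _ => ?_
  change t ^ p * ((t ^ w c * θ c) * _) = _ * (t ^ (p + w c) * _)
  ring

/-- The integral of the derivative of `t ↦ t ^ p * f (dilate w t θ)`, with `φ` and `χ` in the roles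
of `f` and of its partial derivatives along the dilation orbit. -/
theorem integral_pow_mul_add_sum {ι : Type*} (s : Finset ι) (p : ℕ) (w : ι → ℕ) (r : ι → ℝ)
    {φ : ℝ → ℝ} (hφ : Continuous φ) {χ : ι → ℝ → ℝ} (hχ : ∀ c, Continuous (χ c)) :
    (IntervalIntegrable (fun t => (p * t ^ (p - 1)) * φ t + t ^ p *
        ∑ c ∈ s, (w c * t ^ (w c - 1) * r c) * χ c t) volume 0 1) ∧
    ∫ t in (0 : ℝ)..1, ((p * t ^ (p - 1)) * φ t + t ^ p *
        ∑ c ∈ s, (w c * t ^ (w c - 1) * r c) * χ c t) =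
      p * (∫ t in (0 : ℝ)..1, t ^ (p - 1) * φ t) +
        ∑ c ∈ s, w c * (r c * ∫ t in (0 : ℝ)..1, t ^ (p + (w c - 1)) * χ c t) := by
  refine ⟨Continuous.intervalIntegrable (by fun_prop) _ _, ?_⟩
  rw [intervalIntegral.integral_add (Continuous.intervalIntegrable (by fun_prop) _ _)
    (Continuous.intervalIntegrable (by fun_prop) _ _)]
  congr 1
  · rw [← intervalIntegral.integral_const_mul]
    exact integral_congr fun t _ => mul_assoc _ _ _
  · simp only [Finset.mul_sum]
    rw [integral_finsetSum fun c _ => Continuous.intervalIntegrable (by fun_prop) _ _]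
    refine Finset.sum_congr rfl fun c _ => ?_
    rw [← mul_assoc, ← intervalIntegral.integral_const_mul]
    refine integral_congr fun t _ => ?_
    simp only [pow_add]
    ring

/-- The fundamental theorem of calculus for `t ↦ t ^ p * f (dilate w t θ)` on `[0, 1]`. For `p = 0`
it reconstructs `f` from its value at the degenerate dilation and averages of its derivatives. The
truncated exponents `p - 1` and `w c - 1` are harmless: they carry a factor `p` or `w c`. -/
theorem average_fundamental (w : JetCoord m → ℕ) (p : ℕ) (f : DiffFun m) :
    f - (0 : ℝ) ^ p • dilation w 0 f =
      (p : ℝ) • average w (p - 1) f +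
        ∑ᶠ c, (w c : ℝ) • (coord c * average w (p + (w c - 1)) (pderiv c f)) := by
  refine DiffFun.ext fun θ => ?_
  have hd : ∀ t : ℝ, HasDerivAt (fun t => t ^ p * f.1 (dilate w t θ))
      ((p * t ^ (p - 1)) * f.1 (dilate w t θ) + t ^ p *
        ∑ᶠ c, (w c * t ^ (w c - 1) * θ c) * (pderiv c f).1 (dilate w t θ)) t := by
    intro t
    refine (hasDerivAt_pow p t).mul (f.hasDerivAt_comp fun c => ?_)
    exact (hasDerivAt_pow (w c) t).mul_const (θ c)
  set s : Finset (JetCoord m) := (finite_pderiv_ne_zero f).toFinset with hs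
  have hfs : ∀ t : ℝ, ∑ᶠ c, (w c * t ^ (w c - 1) * θ c) * (pderiv c f).1 (dilate w t θ) =
      ∑ c ∈ s, (w c * t ^ (w c - 1) * θ c) * (pderiv c f).1 (dilate w t θ) := by
    intro t
    refine finsum_eq_sum_of_support_subset _ fun c hc => ?_
    simp only [hs, Set.Finite.coe_toFinset]
    intro h
    refine hc ?_
    have : (pderiv c f).1 (dilate w t θ) = 0 := by rw [h]; rfl
    simp [this]
  simp only [hfs] at hd
  have hcont : ∀ g : DiffFun m, Continuous fun t => g.1 (dilate w t θ) :=
    fun g => (g.contDiff_dilate w θ).continuous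
  obtain ⟨hi, hv⟩ := integral_pow_mul_add_sum s p w θ (hcont f) fun c => hcont (pderiv c f)
  have hint := integral_eq_sub_of_hasDerivAt (a := 0) (b := 1) (fun t _ => hd t) hi
  rw [hv] at hint
  simp only [one_pow, one_mul, dilate_one] at hint
  change f.1 θ - 0 ^ p * f.1 (dilate w 0 θ) = p * (average w (p - 1) f).1 θ + DiffFun.eval θ _
  rw [← hint, finsum_eq_sum_of_support_subset (s := s) _ (by
    intro c hc
    simp only [hs, Set.Finite.coe_toFinset]
    intro h
    exact hc (by simp [h])), map_sum]
  rfl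

theorem finsum_of_injective {α β M : Type*} [AddCommMonoid M] {σ : β → α}
    (hσ : Function.Injective σ) (f : α → M) (h : ∀ a, a ∉ Set.range σ → f a = 0) :
    ∑ᶠ a, f a = ∑ᶠ b, f (σ b) := by
  rw [← finsum_mem_range hσ, ← finsum_mem_univ]
  refine finsum_mem_inter_support_eq' _ _ _ fun a ha => ?_
  simp only [Set.mem_univ, true_iff]
  by_contra hn
  exact ha (h a hn)

/-! ### Vector fields on the jet space -/

theorem vectorField_apply (X : JetCoord m → DiffFun m) (f : DiffFun m) :
    vectorField X f = ∑ᶠ c, X c * pderiv c f := rfl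

theorem vectorField_eq_sum (X : JetCoord m → DiffFun m) (f : DiffFun m)
    {s : Finset (JetCoord m)} (hs : ∀ c, c ∉ s → pderiv c f = 0) :
    vectorField X f = ∑ c ∈ s, X c * pderiv c f :=
  finsum_eq_sum_of_support_subset _ fun c hc => by
    by_contra h
    exact hc (by simp [hs c h])

theorem exists_finset_pderiv (f : DiffFun m) :
    ∃ s : Finset (JetCoord m), ∀ c, c ∉ s → pderiv c f = 0 :=
  ⟨(finite_pderiv_ne_zero f).toFinset, fun c hc => by simpa using hc⟩

theorem vectorField_coord (X : JetCoord m → DiffFun m) (c : JetCoord m) :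
    vectorField X (coord c) = X c := by
  rw [vectorField_apply, finsum_eq_single _ c fun d hd => by simp [pderiv_coord, hd]]
  simp [pderiv_coord]

theorem pderiv_vectorField (X : JetCoord m → DiffFun m) (c : JetCoord m) (f : DiffFun m) :
    pderiv c (vectorField X f) =
      vectorField X (pderiv c f) + vectorField (fun d => pderiv c (X d)) f := by
  obtain ⟨s, hs⟩ := exists_finset_pderiv f
  rw [vectorField_eq_sum _ f hs, vectorField_eq_sum _ f hs,
    vectorField_eq_sum (s := s) _ (pderiv c f) fun d hd => by rw [pderiv_comm, hs d hd, map_zero],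
    map_sum, ← Finset.sum_add_distrib]
  refine Finset.sum_congr rfl fun d _ => ?_
  rw [Derivation.leibniz, pderiv_comm c d, smul_eq_mul, smul_eq_mul, mul_comm (pderiv d f)]

theorem vectorField_comm (X Y : JetCoord m → DiffFun m)
    (hXY : ∀ c, vectorField X (Y c) = vectorField Y (X c)) (f : DiffFun m) :
    vectorField X (vectorField Y f) = vectorField Y (vectorField X f) := by
  obtain ⟨s, hs⟩ := exists_finset_pderiv f
  have key : ∀ X Y : JetCoord m → DiffFun m, vectorField X (vectorField Y f) =
      ∑ d ∈ s, ∑ c ∈ s, Y d * (X c * pderiv c (pderiv d f)) +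
        ∑ d ∈ s, vectorField X (Y d) * pderiv d f := by
    intro X Y
    rw [vectorField_eq_sum Y f hs, map_sum, ← Finset.sum_add_distrib]
    refine Finset.sum_congr rfl fun d _ => ?_
    rw [Derivation.leibniz, smul_eq_mul, smul_eq_mul, vectorField_eq_sum (s := s) X (pderiv d f)
      fun c hc => by rw [pderiv_comm, hs c hc, map_zero], Finset.mul_sum,
      mul_comm (pderiv d f)]
  rw [key X Y, key Y X, Finset.sum_comm]
  simp only [hXY]
  congr 1
  refine Finset.sum_congr rfl fun c _ => Finset.sum_congr rfl fun d _ => ?_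
  rw [pderiv_comm d c]
  ring

theorem Dx_apply (f : DiffFun m) : Dx m f = ∑ᶠ c, Dx m (coord c) * pderiv c f := by
  conv_lhs => rw [Dx, vectorField_apply]
  simp only [Dx, vectorField_coord]

theorem Dy_apply (f : DiffFun m) : Dy m f = ∑ᶠ c, Dy m (coord c) * pderiv c f := by
  conv_lhs => rw [Dy, vectorField_apply]
  simp only [Dy, vectorField_coord]

@[simp] theorem Dx_coord_x : Dx m (coord .x) = 1 := vectorField_coord _ _
@[simp] theorem Dx_coord_y : Dx m (coord .y) = 0 := vectorField_coord _ _
@[simp] theorem Dx_coord_u (k : Fin m) (a b : ℕ) :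
    Dx m (coord (.u k (a, b))) = coord (.u k (a + 1, b)) := vectorField_coord _ _
@[simp] theorem Dy_coord_x : Dy m (coord .x) = 0 := vectorField_coord _ _
@[simp] theorem Dy_coord_y : Dy m (coord .y) = 1 := vectorField_coord _ _
@[simp] theorem Dy_coord_u (k : Fin m) (a b : ℕ) :
    Dy m (coord (.u k (a, b))) = coord (.u k (a, b + 1)) := vectorField_coord _ _

theorem Dx_Dy_comm (f : DiffFun m) : Dx m (Dy m f) = Dy m (Dx m f) := by
  refine vectorField_comm _ _ (fun c => ?_) f
  change Dx m _ = Dy m _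
  rcases c with _ | _ | ⟨k, a, b⟩ <;> simp

theorem pderiv_Dx (c : JetCoord m) (f : DiffFun m) :
    pderiv c (Dx m f) = Dx m (pderiv c f) + ∑ᶠ d, pderiv c (Dx m (coord d)) * pderiv d f := by
  rw [Dx, pderiv_vectorField]
  simp only [vectorField_coord]
  rfl

theorem pderiv_Dy (c : JetCoord m) (f : DiffFun m) :
    pderiv c (Dy m f) = Dy m (pderiv c f) + ∑ᶠ d, pderiv c (Dy m (coord d)) * pderiv d f := by
  rw [Dy, pderiv_vectorField]
  simp only [vectorField_coord]
  rfl

theorem pderiv_u_Dx_of_notMem (k : Fin m) {I : ℕ × ℕ}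
    (hI : I ∉ Set.range fun J : ℕ × ℕ => (J.1 + 1, J.2)) (f : DiffFun m) :
    pderiv (.u k I) (Dx m f) = Dx m (pderiv (.u k I) f) := by
  rw [pderiv_Dx, finsum_eq_zero_of_forall_eq_zero, add_zero]
  rintro (_ | _ | ⟨k', a, b⟩)
  · simp
  · simp
  · rw [Dx_coord_u, pderiv_coord, if_neg, zero_mul]
    rintro h
    injection h with h1 h2
    exact hI ⟨(a, b), h2.symm⟩

/-- The commutator of `∂/∂u^k_{I,x}` and `D_x` is `∂/∂u^k_I`. -/
theorem pderiv_u_Dx_succ (k : Fin m) (I : ℕ × ℕ) (f : DiffFun m) :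
    pderiv (.u k (I.1 + 1, I.2)) (Dx m f) =
      Dx m (pderiv (.u k (I.1 + 1, I.2)) f) + pderiv (.u k I) f := by
  rw [pderiv_Dx, finsum_eq_single _ (.u k I)]
  · rw [Dx_coord_u, pderiv_coord, if_pos rfl, one_mul]
  · rintro (_ | _ | ⟨k', a, b⟩) hd
    · simp
    · simp
    · rw [Dx_coord_u, pderiv_coord, if_neg, zero_mul]
      rintro h
      simp only [JetCoord.u.injEq, Prod.mk.injEq, add_left_inj] at h
      exact hd (by rw [h.1, ← h.2.1, ← h.2.2])

theorem pderiv_u_Dy_of_notMem (k : Fin m) {I : ℕ × ℕ}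
    (hI : I ∉ Set.range fun J : ℕ × ℕ => (J.1, J.2 + 1)) (f : DiffFun m) :
    pderiv (.u k I) (Dy m f) = Dy m (pderiv (.u k I) f) := by
  rw [pderiv_Dy, finsum_eq_zero_of_forall_eq_zero, add_zero]
  rintro (_ | _ | ⟨k', a, b⟩)
  · simp
  · simp
  · rw [Dy_coord_u, pderiv_coord, if_neg, zero_mul]
    rintro h
    injection h with h1 h2
    exact hI ⟨(a, b), h2.symm⟩

/-- The commutator of `∂/∂u^k_{I,y}` and `D_y` is `∂/∂u^k_I`. -/
theorem pderiv_u_Dy_succ (k : Fin m) (I : ℕ × ℕ) (f : DiffFun m) :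
    pderiv (.u k (I.1, I.2 + 1)) (Dy m f) =
      Dy m (pderiv (.u k (I.1, I.2 + 1)) f) + pderiv (.u k I) f := by
  rw [pderiv_Dy, finsum_eq_single _ (.u k I)]
  · rw [Dy_coord_u, pderiv_coord, if_pos rfl, one_mul]
  · rintro (_ | _ | ⟨k', a, b⟩) hd
    · simp
    · simp
    · rw [Dy_coord_u, pderiv_coord, if_neg, zero_mul]
      rintro h
      simp only [JetCoord.u.injEq, Prod.mk.injEq, add_left_inj] at h
      exact hd (by rw [h.1, ← h.2.1, ← h.2.2])

/-! ### Iterated total derivatives and integration by parts -/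

/-- The iterated total derivative `DI I` as a linear map. -/
noncomputable def linDI (I : ℕ × ℕ) : Module.End ℝ (DiffFun m) :=
  (Dx m : DiffFun m →ₗ[ℝ] DiffFun m) ^ I.1 * (Dy m : DiffFun m →ₗ[ℝ] DiffFun m) ^ I.2

theorem linDI_apply (I : ℕ × ℕ) (f : DiffFun m) : linDI I f = DI I f := by
  rw [linDI, Module.End.mul_apply, Module.End.pow_apply, Module.End.pow_apply]
  rfl

theorem commute_Dx_Dy :
    Commute (Dx m : Module.End ℝ (DiffFun m)) (Dy m : Module.End ℝ (DiffFun m)) :=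
  LinearMap.ext fun f => Dx_Dy_comm f

theorem linDI_succ_left (I : ℕ × ℕ) (f : DiffFun m) :
    linDI (I.1 + 1, I.2) f = linDI I (Dx m f) := by
  have h : (linDI (I.1 + 1, I.2) : Module.End ℝ (DiffFun m)) =
      linDI I * (Dx m : Module.End ℝ (DiffFun m)) := by
    rw [linDI, linDI, pow_succ, mul_assoc, mul_assoc, (commute_Dx_Dy.pow_right I.2).eq]
  rw [h]
  rfl

theorem linDI_succ_right (I : ℕ × ℕ) (f : DiffFun m) :
    linDI (I.1, I.2 + 1) f = linDI I (Dy m f) := by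
  have h : (linDI (I.1, I.2 + 1) : Module.End ℝ (DiffFun m)) =
      linDI I * (Dy m : Module.End ℝ (DiffFun m)) := by
    rw [linDI, linDI, pow_succ, mul_assoc]
  rw [h]
  rfl

theorem linDI_coord (k : Fin m) (I : ℕ × ℕ) : linDI I (coord (.u k (0, 0))) = coord (.u k I) := by
  have h : ∀ b, ((Dy m)^[b] (coord (.u k (0, 0)))) = coord (.u k (0, b)) := by
    intro b
    induction b with
    | zero => rfl
    | succ b ih => rw [Function.iterate_succ_apply', ih, Dy_coord_u]
  have h' : ∀ a b, ((Dx m)^[a] (coord (.u k (0, b)))) = coord (.u k (a, b)) := by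
    intro a b
    induction a with
    | zero => rfl
    | succ a ih => rw [Function.iterate_succ_apply', ih, Dx_coord_u]
  rw [linDI_apply, DI, h, h']

/-- The total divergence `(a, b) ↦ D_y a - D_x b`; its sign convention is that of the curvature. -/
noncomputable def divergence (m : ℕ) : DiffFun m × DiffFun m →ₗ[ℝ] DiffFun m :=
  (Dy m : DiffFun m →ₗ[ℝ] DiffFun m) ∘ₗ LinearMap.fst ℝ _ _ -
    (Dx m : DiffFun m →ₗ[ℝ] DiffFun m) ∘ₗ LinearMap.snd ℝ _ _

theorem divergence_apply (p : DiffFun m × DiffFun m) :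
    divergence m p = Dy m p.1 - Dx m p.2 := rfl

theorem Dy_mem_range_divergence (f : DiffFun m) : Dy m f ∈ LinearMap.range (divergence m) :=
  ⟨(f, 0), by simp [divergence_apply]⟩

theorem Dx_mem_range_divergence (f : DiffFun m) : Dx m f ∈ LinearMap.range (divergence m) :=
  ⟨(0, -f), by simp [divergence_apply]⟩

/-- Integration by parts for the powers of a derivation, modulo a subspace that contains its
image. -/
theorem mul_pow_sub_mem (V : Submodule ℝ (DiffFun m)) (D : Derivation ℝ (DiffFun m) (DiffFun m))
    (hD : ∀ f, D f ∈ V) (a : ℕ) (f g : DiffFun m) :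
    f * ((D : DiffFun m →ₗ[ℝ] DiffFun m) ^ a) g -
      (-1 : ℝ) ^ a • (((D : DiffFun m →ₗ[ℝ] DiffFun m) ^ a) f * g) ∈ V := by
  induction a generalizing f g with
  | zero => simp
  | succ a ih =>
    have h1 := ih (D f) g
    have h2 := hD (f * ((D : DiffFun m →ₗ[ℝ] DiffFun m) ^ a) g)
    convert V.sub_mem h2 h1 using 1
    have h3 : ∀ h, ((D : DiffFun m →ₗ[ℝ] DiffFun m) ^ (a + 1)) h =
        ((D : DiffFun m →ₗ[ℝ] DiffFun m) ^ a) (D h) := fun h => by rw [pow_succ]; rfl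
    have h4 : ∀ h, ((D : DiffFun m →ₗ[ℝ] DiffFun m) ^ (a + 1)) h =
        D (((D : DiffFun m →ₗ[ℝ] DiffFun m) ^ a) h) := fun h => by rw [pow_succ']; rfl
    rw [Derivation.leibniz, h4 g, h3 f, pow_succ, smul_eq_mul, smul_eq_mul, mul_neg_one, neg_smul]
    ring

/-- Integration by parts: up to a total divergence, `D_I` can be moved to the other factor at the
expense of the sign `(-1)^|I|`. -/
theorem mul_linDI_sub_mem (I : ℕ × ℕ) (f g : DiffFun m) :
    f * linDI I g - sgn I • (linDI I f * g) ∈ LinearMap.range (divergence m) := by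
  have h1 := mul_pow_sub_mem _ (Dx m) Dx_mem_range_divergence I.1 f
    (((Dy m : DiffFun m →ₗ[ℝ] DiffFun m) ^ I.2) g)
  have h2 := mul_pow_sub_mem _ (Dy m) Dy_mem_range_divergence I.2
    (((Dx m : DiffFun m →ₗ[ℝ] DiffFun m) ^ I.1) f) g
  convert Submodule.add_mem _ h1 (Submodule.smul_mem _ ((-1 : ℝ) ^ I.1) h2) using 1
  have h3 : ((Dy m : DiffFun m →ₗ[ℝ] DiffFun m) ^ I.2)
      (((Dx m : DiffFun m →ₗ[ℝ] DiffFun m) ^ I.1) f)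
      = linDI I f := by
    rw [linDI, (commute_Dx_Dy.pow_pow I.1 I.2).eq]
    rfl
  rw [h3, smul_sub, smul_smul, ← pow_add, sub_add_sub_cancel]
  rfl

/-! ### The Euler operator -/

theorem finite_pderiv_u_ne_zero (k : Fin m) (f : DiffFun m) :
    {I | pderiv (.u k I) f ≠ 0}.Finite :=
  (finite_pderiv_ne_zero f).preimage
    (f := fun I : ℕ × ℕ => JetCoord.u k I) fun I _ J _ h => by injection h

theorem finite_support_sgn_linDI {g : ℕ × ℕ → DiffFun m} (hg : {I | g I ≠ 0}.Finite) :
    (Function.support fun I => sgn I • linDI I (g I)).Finite :=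
  hg.subset fun I hI h => hI (by simp [h])

/-- The component `E_k = ∑_I (-1)^|I| D_I ∘ ∂/∂u^k_I` of the Euler operator. -/
noncomputable def euler (k : Fin m) : DiffFun m →ₗ[ℝ] DiffFun m where
  toFun f := ∑ᶠ I, sgn I • linDI I (pderiv (.u k I) f)
  map_add' f g := by
    simp only [map_add, smul_add]
    exact finsum_add_distrib (finite_support_sgn_linDI (finite_pderiv_u_ne_zero k f))
      (finite_support_sgn_linDI (finite_pderiv_u_ne_zero k g))
  map_smul' r f := by
    rw [RingHom.id_apply, smul_finsum' r (finite_support_sgn_linDI (finite_pderiv_u_ne_zero k f))]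
    exact finsum_congr fun I => by rw [Derivation.map_smul, map_smul, smul_comm]

theorem euler_apply (k : Fin m) (f : DiffFun m) :
    euler k f = ∑ᶠ I, sgn I • linDI I (pderiv (.u k I) f) := rfl

/-- The sum defining `E_k (D f)` telescopes when `D` is a total derivative and `σ` the shift of
multiindices that it induces on the jet variables. -/
theorem euler_eq_zero_of_shift (k : Fin m) {σ : ℕ × ℕ → ℕ × ℕ} (hσ : Function.Injective σ)
    (D : Derivation ℝ (DiffFun m) (DiffFun m))
    (h1 : ∀ I, I ∉ Set.range σ → ∀ f, pderiv (.u k I) (D f) = D (pderiv (.u k I) f))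
    (h2 : ∀ I f, pderiv (.u k (σ I)) (D f) = D (pderiv (.u k (σ I)) f) + pderiv (.u k I) f)
    (h3 : ∀ I f, sgn (σ I) • linDI (σ I) f = -(sgn I • linDI I (D f))) (f : DiffFun m) :
    euler k (D f) = 0 := by
  have hf := finite_pderiv_u_ne_zero k f
  have hf' := finite_pderiv_u_ne_zero k (D f)
  have e1 : (Function.support fun I => sgn I • linDI I (D (pderiv (.u k I) f))).Finite :=
    finite_support_sgn_linDI (hf.subset fun I hI h => hI (by simp [h]))
  have e2 : (Function.support fun I => sgn I • linDI I
      (pderiv (.u k I) (D f) - D (pderiv (.u k I) f))).Finite :=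
    finite_support_sgn_linDI ((hf.union hf').subset fun I hI => by
      by_contra h
      simp only [Set.mem_union, Set.mem_ofPred_eq, not_or, not_not] at h
      exact hI (by simp [h.1, h.2]))
  have e3 : ∑ᶠ I, sgn I • linDI I (pderiv (.u k I) (D f) - D (pderiv (.u k I) f)) =
      ∑ᶠ I, -(sgn I • linDI I (D (pderiv (.u k I) f))) := by
    rw [finsum_of_injective hσ _ fun I hI => by rw [h1 I hI, sub_self, map_zero, smul_zero]]
    refine finsum_congr fun I => ?_
    rw [h2, add_sub_cancel_left, h3]
  have e4 : euler k (D f) = ∑ᶠ I, (sgn I • linDI I (D (pderiv (.u k I) f)) +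
      sgn I • linDI I (pderiv (.u k I) (D f) - D (pderiv (.u k I) f))) := by
    refine finsum_congr fun I => ?_
    rw [← smul_add, ← map_add, add_sub_cancel]
  rw [e4, finsum_add_distrib e1 e2, e3, finsum_neg_distrib, add_neg_cancel]

theorem euler_Dx (k : Fin m) (f : DiffFun m) : euler k (Dx m f) = 0 := by
  refine euler_eq_zero_of_shift k (σ := fun J => (J.1 + 1, J.2)) ?_ (Dx m)
    (fun I hI f => pderiv_u_Dx_of_notMem k hI f) (fun I f => pderiv_u_Dx_succ k I f) ?_ f
  · rintro ⟨a, b⟩ ⟨a', b'⟩ h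
    simpa using h
  · intro I f
    rw [linDI_succ_left, sgn, sgn, add_right_comm, pow_succ, mul_neg_one, neg_smul]

theorem euler_Dy (k : Fin m) (f : DiffFun m) : euler k (Dy m f) = 0 := by
  refine euler_eq_zero_of_shift k (σ := fun J => (J.1, J.2 + 1)) ?_ (Dy m)
    (fun I hI f => pderiv_u_Dy_of_notMem k hI f) (fun I f => pderiv_u_Dy_succ k I f) ?_ f
  · rintro ⟨a, b⟩ ⟨a', b'⟩ h
    simpa using h
  · intro I f
    rw [linDI_succ_right, sgn, sgn, ← add_assoc, pow_succ, mul_neg_one, neg_smul]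

theorem euler_eq_zero_of_mem_range_divergence {f : DiffFun m}
    (hf : f ∈ LinearMap.range (divergence m)) (k : Fin m) : euler k f = 0 := by
  obtain ⟨p, rfl⟩ := hf
  rw [divergence_apply, map_sub, euler_Dx, euler_Dy, sub_zero]

/-! ### Exactness at the Euler operator -/

/-- Weight one on the dependent variables, weight zero on the base. -/
def fibreWeight : JetCoord m → ℕ
  | .x => 0
  | .y => 0
  | .u _ _ => 1

/-- Weight one on the coordinate `y` only. -/
def yWeight : JetCoord m → ℕ
  | .x => 0
  | .y => 1
  | .u _ _ => 0

/-- The dilation of the fibres is linear in the jet variables, hence it commutes with the total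
derivatives, and so do its averages. -/
theorem average_Dx (p : ℕ) (f : DiffFun m) :
    average fibreWeight p (Dx m f) = Dx m (average fibreWeight p f) := by
  have h : (Function.support fun c => Dx m (coord c) * pderiv c f).Finite :=
    finite_support_mul_pderiv _ f
  rw [Dx_apply f, Dx_apply (average _ _ f), ← LinearMap.toAddMonoidHom_coe,
    AddMonoidHom.map_finsum _ h]
  refine finsum_congr fun c => ?_
  rw [LinearMap.toAddMonoidHom_coe, pderiv_average]
  rcases c with _ | _ | ⟨k, a, b⟩
  · simp [fibreWeight]
  · simp
  · rw [Dx_coord_u, average_coord_mul]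
    rfl

theorem average_Dy (p : ℕ) (f : DiffFun m) :
    average fibreWeight p (Dy m f) = Dy m (average fibreWeight p f) := by
  have h : (Function.support fun c => Dy m (coord c) * pderiv c f).Finite :=
    finite_support_mul_pderiv _ f
  rw [Dy_apply f, Dy_apply (average _ _ f), ← LinearMap.toAddMonoidHom_coe,
    AddMonoidHom.map_finsum _ h]
  refine finsum_congr fun c => ?_
  rw [LinearMap.toAddMonoidHom_coe, pderiv_average]
  rcases c with _ | _ | ⟨k, a, b⟩
  · simp
  · simp [fibreWeight]
  · rw [Dy_coord_u, average_coord_mul]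
    rfl

theorem average_linDI (p : ℕ) (I : ℕ × ℕ) (f : DiffFun m) :
    average fibreWeight p (linDI I f) = linDI I (average fibreWeight p f) := by
  have h1 : Commute (average (m := m) fibreWeight p) (Dx m : Module.End ℝ (DiffFun m)) :=
    LinearMap.ext fun f => average_Dx p f
  have h2 : Commute (average (m := m) fibreWeight p) (Dy m : Module.End ℝ (DiffFun m)) :=
    LinearMap.ext fun f => average_Dy p f
  exact LinearMap.congr_fun ((h1.pow_right I.1).mul_right (h2.pow_right I.2)).eq f

theorem finsum_mem_submodule {ι : Type*} (V : Submodule ℝ (DiffFun m)) {f : ι → DiffFun m}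
    (hf : ∀ i, f i ∈ V) : ∑ᶠ i, f i ∈ V :=
  finsum_induction (· ∈ V) V.zero_mem (fun _ _ => V.add_mem) hf

/-- A function of `x` and `y` alone is `D_y` of its primitive in `y`, which is written as
`y ∫₀¹ f(x, t y) dt`. -/
theorem mem_range_divergence_of_pderiv_u_eq_zero {f : DiffFun m}
    (hf : ∀ k I, pderiv (.u k I) f = 0) : f ∈ LinearMap.range (divergence m) := by
  have h1 := average_fundamental yWeight 1 f
  rw [finsum_eq_single _ .y (by
    rintro (_ | _ | ⟨k, I⟩) h
    · simp [yWeight]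
    · exact absurd rfl h
    · simp [yWeight])] at h1
  simp only [pow_one, zero_smul, sub_zero, Nat.cast_one, one_smul, yWeight] at h1
  have h2 : Dy m (coord .y * average yWeight 0 f) = f := by
    rw [Dy_apply, finsum_eq_single _ .y]
    · rw [Dy_coord_y, one_mul, Derivation.leibniz, pderiv_average, pderiv_coord, if_pos rfl,
        smul_eq_mul, smul_eq_mul, mul_one, add_comm]
      exact h1.symm
    · rintro (_ | _ | ⟨k, I⟩) h
      · simp
      · exact absurd rfl h
      · rw [Derivation.leibniz, pderiv_average, hf, pderiv_coord, if_neg (by simp)]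
        simp
  rw [← h2]
  exact Dy_mem_range_divergence _

/-- Exactness of the horizontal complex in top degree: a differential function annihilated by the
Euler operator is a total divergence. Along the dilation `t ↦ (x, y, t u)` one has `f - f(x, y, 0)
= ∑ u^k_I ∫₀¹ (∂f/∂u^k_I)(x, y, t u) dt`; integration by parts replaces the right-hand side by
`∑_k u^k ∫₀¹ (E_k f)(x, y, t u) dt = 0`. -/
theorem mem_range_divergence_of_euler_eq_zero {f : DiffFun m} (hf : ∀ k, euler k f = 0) :
    f ∈ LinearMap.range (divergence m) := by
  have h0 : dilation fibreWeight 0 f ∈ LinearMap.range (divergence m) :=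
    mem_range_divergence_of_pderiv_u_eq_zero fun k I => by
      rw [pderiv_dilation]
      simp [fibreWeight]
  have h1 := average_fundamental fibreWeight 0 f
  simp only [pow_zero, one_smul, Nat.cast_zero, zero_smul, zero_add] at h1
  rw [← sub_add_cancel f (dilation fibreWeight 0 f), h1]
  refine Submodule.add_mem _ ?_ h0
  -- `Y c` are the terms of the homotopy formula, and `Z c` the same terms integrated by parts.
  set Y : JetCoord m → DiffFun m := fun c =>
    (fibreWeight c : ℝ) • (coord c * average fibreWeight (fibreWeight c - 1) (pderiv c f)) with hY
  let Z : JetCoord m → DiffFun m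
    | .x => 0
    | .y => 0
    | .u k I => coord (.u k (0, 0)) * average fibreWeight 0 (sgn I • linDI I (pderiv (.u k I) f))
  have hYf : (Function.support Y).Finite :=
    (finite_pderiv_ne_zero f).subset fun c hc h => hc (by simp [hY, h])
  have hZf : (Function.support Z).Finite :=
    (finite_pderiv_ne_zero f).subset fun c hc h => hc (by
      rcases c with _ | _ | ⟨k, I⟩
      · rfl
      · rfl
      · simp [Z, h])
  have hZ : ∑ᶠ c, Z c = 0 := by
    rw [finsum_of_injective (σ := fun q : Fin m × (ℕ × ℕ) => JetCoord.u q.1 q.2)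
      (by rintro ⟨k, I⟩ ⟨k', I'⟩ h; simpa using h) Z (by
        rintro (_ | _ | ⟨k, I⟩) h
        · rfl
        · rfl
        · exact absurd ⟨(k, I), rfl⟩ h)]
    rw [finsum_curry _ (hZf.preimage (f := fun q : Fin m × (ℕ × ℕ) => JetCoord.u q.1 q.2)
      (by rintro ⟨k, I⟩ _ ⟨k', I'⟩ _ h; simpa using h))]
    refine finsum_eq_zero_of_forall_eq_zero fun k => ?_
    have := congrArg (fun g => coord (.u k (0, 0)) * average fibreWeight 0 g) (hf k)
    simp only [euler_apply, map_zero, mul_zero] at this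
    have hfin := finite_support_sgn_linDI (finite_pderiv_u_ne_zero k f)
    rw [← this, ← LinearMap.toAddMonoidHom_coe, AddMonoidHom.map_finsum _ hfin,
      ← smul_eq_mul, smul_finsum']
    · rfl
    · exact hfin.subset fun I hI h => hI (by simp only [h, map_zero])
  have hsub : ∑ᶠ c, (Y c - Z c) ∈ LinearMap.range (divergence m) := by
    refine finsum_mem_submodule _ fun c => ?_
    rcases c with _ | _ | ⟨k, I⟩
    · simp [hY, Z, fibreWeight]
    · simp [hY, Z, fibreWeight]
    · have h := mul_linDI_sub_mem I (average fibreWeight 0 (pderiv (.u k I) f))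
        (coord (.u k (0, 0)))
      convert h using 1
      simp only [hY, Z, fibreWeight]
      rw [linDI_coord, map_smul, average_linDI]
      simp [mul_comm]
  rwa [finsum_sub_distrib hYf hZf, hZ, sub_zero] at hsub

/-! ### Matrix entries of `𝔤`-valued functions -/

variable {𝔤 : LieSubalgebra ℝ (Matrix (Fin n) (Fin n) ℝ)}

/-- The entry in position `(i, j)` of a `𝔤`-valued function. -/
def entry (i j : Fin n) : GFun 𝔤 m →ₗ[ℝ] DiffFun m where
  toFun M := M.1 i j
  map_add' _ _ := rfl
  map_smul' _ _ := rfl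

theorem GFun.ext_entry {M L : GFun 𝔤 m} (h : ∀ i j, entry i j M = entry i j L) : M = L :=
  Subtype.ext (Matrix.ext h)

theorem entry_smul (f : DiffFun m) (M : GFun 𝔤 m) (i j : Fin n) :
    entry i j (f • M) = f * entry i j M := rfl

theorem entry_entrywise (D : Derivation ℝ (DiffFun m) (DiffFun m)) (M : GFun 𝔤 m) (i j : Fin n) :
    entry i j (entrywise D M) = D (entry i j M) := rfl

theorem entry_gDI (I : ℕ × ℕ) (M : GFun 𝔤 m) (i j : Fin n) :
    entry i j (gDI I M) = linDI I (entry i j M) := by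
  have h : ∀ (D : Derivation ℝ (DiffFun m) (DiffFun m)) (a : ℕ) (M : GFun 𝔤 m),
      entry i j ((entrywise D)^[a] M) = D^[a] (entry i j M) := fun D a =>
    Function.Semiconj.iterate_right (f := entry i j) (fun M => entry_entrywise D M i j) a
  rw [linDI_apply, gDI, DI, h, h]

theorem entry_finsum {ι : Type*} {f : ι → GFun 𝔤 m} (hf : (Function.support f).Finite)
    (i j : Fin n) : entry i j (∑ᶠ c, f c) = ∑ᶠ c, entry i j (f c) :=
  (entry i j : GFun 𝔤 m →ₗ[ℝ] DiffFun m).toAddMonoidHom.map_finsum hf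

theorem lie_eq_zero_of_isLieAbelian (h𝔤 : IsLieAbelian 𝔤) (A B : GFun 𝔤 m) : ⁅A, B⁆ = 0 := by
  refine GFun.ext_entry fun i j => DiffFun.ext fun θ => ?_
  have h : ⁅evalAt θ A.1, evalAt θ B.1⁆ = 0 :=
    congrArg Subtype.val (h𝔤.trivial ⟨_, A.2 θ⟩ ⟨_, B.2 θ⟩)
  rw [Ring.lie_def, ← evalAt_mul, ← evalAt_mul, ← evalAt_sub] at h
  exact congrFun (congrFun h i) j

theorem curvature_of_isLieAbelian (h𝔤 : IsLieAbelian 𝔤) (A B : GFun 𝔤 m) :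
    curvature A B = entrywise (Dy m) A - entrywise (Dx m) B := by
  rw [curvature, lie_eq_zero_of_isLieAbelian h𝔤, add_zero]

theorem hatDI_of_isLieAbelian (h𝔤 : IsLieAbelian 𝔤) (A B : GFun 𝔤 m) (I : ℕ × ℕ) (M : GFun 𝔤 m) :
    hatDI A B I M = gDI I M := by
  simp only [hatDI, lie_eq_zero_of_isLieAbelian h𝔤, sub_zero]
  rfl

theorem finite_entrywise_pderiv_u_ne_zero (k : Fin m) (M : GFun 𝔤 m) :
    {I | entrywise (pderiv (.u k I)) M ≠ 0}.Finite := by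
  refine (Set.finite_iUnion fun q : Fin n × Fin n =>
    finite_pderiv_u_ne_zero k (entry q.1 q.2 M)).subset fun I hI => ?_
  by_contra h
  simp only [Set.mem_iUnion, Set.mem_ofPred_eq, not_exists, not_not] at h
  exact hI (GFun.ext_entry fun i j => h (i, j))

theorem finite_support_sgn_gDI {g : ℕ × ℕ → GFun 𝔤 m} (hg : {I | g I ≠ 0}.Finite) :
    (Function.support fun I => sgn I • gDI I (g I)).Finite :=
  hg.subset fun I hI h => hI (GFun.ext_entry fun i j => by
    rw [map_smul, entry_gDI, h, map_zero, map_zero, smul_zero])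

/-- The two sums of the Euler operator applied to `∑ F^l Q_l` by the Leibniz rule, entry by entry.
-/
theorem entry_euler_sum {N : ℕ} (F : Fin N → DiffFun m) (Q : Fin N → GFun 𝔤 m) (k : Fin m)
    (i j : Fin n) :
    entry i j ((∑ l, ∑ᶠ I : ℕ × ℕ, sgn I • gDI I (pderiv (.u k I) (F l) • Q l)) +
      (∑ l, ∑ᶠ I : ℕ × ℕ, sgn I • gDI I (F l • entrywise (pderiv (.u k I)) (Q l)))) =
      euler k (entry i j (∑ l, F l • Q l)) := by
  rw [map_add, map_sum, map_sum, map_sum, map_sum, ← Finset.sum_add_distrib]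
  refine Finset.sum_congr rfl fun l _ => ?_
  have hF : {I | pderiv (.u k I) (F l) • Q l ≠ 0}.Finite :=
    (finite_pderiv_u_ne_zero k (F l)).subset fun I hI h => hI (by rw [h, zero_smul])
  have hQ : {I | F l • entrywise (pderiv (.u k I)) (Q l) ≠ 0}.Finite :=
    (finite_entrywise_pderiv_u_ne_zero k (Q l)).subset fun I hI h => hI (by rw [h, smul_zero])
  have hF' : {I | entry i j (pderiv (.u k I) (F l) • Q l) ≠ 0}.Finite :=
    hF.subset fun I hI h => hI (by rw [h, map_zero])
  have hQ' : {I | entry i j (F l • entrywise (pderiv (.u k I)) (Q l)) ≠ 0}.Finite :=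
    hQ.subset fun I hI h => hI (by rw [h, map_zero])
  rw [entry_finsum (finite_support_sgn_gDI hF), entry_finsum (finite_support_sgn_gDI hQ)]
  simp only [map_smul, entry_gDI]
  rw [← finsum_add_distrib (finite_support_sgn_linDI hF') (finite_support_sgn_linDI hQ'),
    euler_apply]
  refine finsum_congr fun I => ?_
  rw [← smul_add, ← map_add, entry_smul, entry_smul, entry_smul, entry_entrywise,
    Derivation.leibniz, smul_eq_mul, smul_eq_mul, add_comm, mul_comm (entry i j (Q l))]

/-- For `Q_l = ∑_I (-1)^|I| D_I C_l^I`, the function `∑ F^l Q_l` differs from `∑ D_I(F^l) C_l^I`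
by a total divergence, and the latter is itself the divergence of `(A, B)` since `𝔤` is abelian.
-/
theorem entry_mem_range_divergence_of_curvature {N : ℕ} (h𝔤 : IsLieAbelian 𝔤)
    (F : Fin N → DiffFun m) {A B : GFun 𝔤 m} {C : Fin N → (ℕ × ℕ →₀ GFun 𝔤 m)}
    (h : curvature A B = ∑ l, (C l).sum fun I c => DI I (F l) • c) (i j : Fin n) :
    entry i j (∑ l, F l • ∑ I ∈ (C l).support, sgn I • gDI I (C l I)) ∈
      LinearMap.range (divergence m) := by
  have h1 : entry i j (∑ l, (C l).sum fun I c => DI I (F l) • c) ∈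
      LinearMap.range (divergence m) := by
    rw [← h, curvature_of_isLieAbelian h𝔤]
    exact ⟨(entry i j A, entry i j B), rfl⟩
  rw [← sub_add_cancel (entry i j (∑ l, F l • _)) (entry i j (∑ l, (C l).sum _))]
  refine Submodule.add_mem _ ?_ h1
  rw [map_sum, map_sum, ← Finset.sum_sub_distrib]
  refine Submodule.sum_mem _ fun l _ => ?_
  rw [entry_smul, Finsupp.sum, map_sum, map_sum, Finset.mul_sum, ← Finset.sum_sub_distrib]
  refine Submodule.sum_mem _ fun I _ => ?_
  have h2 := Submodule.smul_mem _ (sgn I) (mul_linDI_sub_mem I (F l) (entry i j (C l I)))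
  have h3 : sgn I * sgn I = 1 := by rw [sgn, ← mul_pow]; simp
  rw [smul_sub, smul_smul, h3, one_smul] at h2
  rwa [map_smul, entry_gDI, entry_smul, mul_smul_comm, ← linDI_apply]

/-- A linear section of the divergence on its range, applied entrywise, produces potentials with
values in `𝔤`. -/
theorem exists_potentials (M : GFun 𝔤 m)
    (hM : ∀ i j, entry i j M ∈ LinearMap.range (divergence m)) :
    ∃ A B : GFun 𝔤 m, M = entrywise (Dy m) A - entrywise (Dx m) B := by
  obtain ⟨S, hS⟩ := (divergence m).rangeRestrict.exists_rightInverse_of_surjective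
    (LinearMap.range_rangeRestrict _)
  -- The choice of potentials has to be linear on all of `𝓕(π)` in order to preserve `𝔤`-valued
  -- functions.
  obtain ⟨T, hT⟩ := S.exists_extend
  have key : ∀ f ∈ LinearMap.range (divergence m), divergence m (T f) = f := by
    intro f hf
    have h1 : T f = S ⟨f, hf⟩ := LinearMap.congr_fun hT ⟨f, hf⟩
    rw [h1]
    exact congrArg Subtype.val (LinearMap.congr_fun hS ⟨f, hf⟩)
  refine ⟨⟨M.1.map (LinearMap.fst ℝ _ _ ∘ₗ T), map_mem_gFun _ M.2⟩,
    ⟨M.1.map (LinearMap.snd ℝ _ _ ∘ₗ T), map_mem_gFun _ M.2⟩, GFun.ext_entry fun i j => ?_⟩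
  exact (key _ (hM i j)).symm

/-- If `∑ F^l Q_l` is annihilated by the Euler operator, it is the curvature of some `(A, B)`; the
decomposition of the curvature with `C_l^I = Q_l` for `I = (0, 0)` and `0` otherwise then has
characteristic element `Q`. -/
theorem exists_characteristic_of_euler_eq_zero {N : ℕ} (h𝔤 : IsLieAbelian 𝔤)
    (F : Fin N → DiffFun m) (Q : Fin N → GFun 𝔤 m)
    (hQ : ∀ k i j, euler k (entry i j (∑ l, F l • Q l)) = 0) :
    ∃ Z : ZeroCurvRep 𝔤 F, IsCharacteristicElement Z fun l => restrict F (Q l) := by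
  obtain ⟨A, B, hAB⟩ := exists_potentials (∑ l, F l • Q l) fun i j =>
    mem_range_divergence_of_euler_eq_zero fun k => hQ k i j
  have hc : curvature A B = ∑ l, F l • Q l := by rw [curvature_of_isLieAbelian h𝔤, hAB]
  have hI : restrict F (curvature A B) = 0 := by
    rw [hc]
    refine (LieSubmodule.Quotient.mk_eq_zero' (N := gIdeal 𝔤 F)).2 fun i j => ?_
    change entry i j _ ∈ _
    rw [map_sum]
    exact Ideal.sum_mem _ fun l _ =>
      Ideal.mul_mem_right _ _ (Ideal.subset_span ⟨(l, (0, 0)), rfl⟩)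
  refine ⟨⟨restrict F A, restrict F B, A, B, rfl, rfl, hI⟩, A, B,
    fun l => Finsupp.single (0, 0) (Q l), rfl, rfl, ?_, fun l => congrArg (restrict F) ?_⟩
  · rw [hc]
    refine Finset.sum_congr rfl fun l _ => ?_
    exact (Finsupp.sum_single_index (a := ((0 : ℕ), (0 : ℕ))) (b := Q l)
      (h := fun I c => DI I (F l) • c) (smul_zero (DI (0, 0) (F l)))).symm
  -- If `Q l = 0`, the support of the decomposition is empty.
  · by_cases h : Q l = 0
    · simp [h]
    · refine Eq.trans ?_ (Finset.sum_congr (Finsupp.support_single ((0 : ℕ), (0 : ℕ)) h)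
        fun _ _ => rfl).symm
      rw [Finset.sum_singleton, Finsupp.single_eq_same]
      simp [sgn, hatDI]

end JetZCR

theorem proposition4p3 {m n N : ℕ} (𝔤 : LieSubalgebra ℝ (Matrix (Fin n) (Fin n) ℝ))
    (h𝔤 : IsLieAbelian 𝔤) (F : Fin N → DiffFun m) (hF : IsRegularSystem F)
    (ψ : Fin N → GFunOn 𝔤 F) :
    (∃ Z : ZeroCurvRep 𝔤 F, IsCharacteristicElement Z ψ) ↔
      ∃ Q : Fin N → GFun 𝔤 m, (∀ l, restrict F (Q l) = ψ l) ∧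
        ∀ k : Fin m,
          (∑ l, ∑ᶠ I : ℕ × ℕ, sgn I • gDI I (pderiv (.u k I) (F l) • Q l)) +
            (∑ l, ∑ᶠ I : ℕ × ℕ, sgn I • gDI I (F l • entrywise (pderiv (.u k I)) (Q l))) = 0 := by
  constructor
  · rintro ⟨Z, A, B, C, -, -, hC, hχ⟩
    refine ⟨fun l => ∑ I ∈ (C l).support, sgn I • gDI I (C l I), fun l => ?_, fun k => ?_⟩
    · rw [hχ l]
      simp only [hatDI_of_isLieAbelian h𝔤]
    · refine GFun.ext_entry fun i j => ?_
      rw [entry_euler_sum, map_zero]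
      exact euler_eq_zero_of_mem_range_divergence
        (entry_mem_range_divergence_of_curvature h𝔤 F hC i j) k
  · rintro ⟨Q, hQψ, hQ⟩
    obtain rfl : (fun l => restrict F (Q l)) = ψ := funext hQψ
    refine exists_characteristic_of_euler_eq_zero h𝔤 F Q fun k i j => ?_
    rw [← entry_euler_sum, hQ k, map_zero]
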